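/- Let $\Bbbk$ be an algebraically closed field of characteristic zero and let $q\in\Bbbk^{\times}$ not be a root of unity. Let $U^+=U_q^+(B_2)$ be the associative unital $\Bbbk$-algebra generated by $e_1,e_2$ with the quantum Serre relations $$e_1^2e_2-(q^2+q^{-2})e_1e_2e_1+e_2e_1^2=0,$$ $$e_2^3e_1-(q^2+1+q^{-2})e_2^2e_1e_2+(q^2+1+q^{-2})e_2e_1e_2^2-e_1e_2^3=0,$$ with its canonical grading $U^+=\bigoplus_{n\ge 0}U_n$ in which $e_1$ and $e_2$ have degree one, that is, $U_n$ is the linear span of the words of length $n$ in $e_1,e_2$. Put $$e_3=e_1e_2-q^2e_2e_1,\quad z=e_2e_3-q^2e_3e_2,\quad w=e_2e_3-e_3e_2,\quad z'=e_1w-q^{-4}we_1.$$ Let $Z(U^+)$ be the center of $U^+$, and let $N(U^+)$ be the set of normal (normalizing) elements of $U^+$, i.e. of those $f\in U^+$ with $fU^+=U^+f$. Then $$N(U^+)=Z(U^+)=\Bbbk[z,z'],$$ where $\Bbbk[z,z']$ is the subalgebra generated by $z$ and $z'$, and it is a polynomial algebra in the two variables $z,z'$ (there is an isomorphism of $\Bbbk$-algebras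 from the polynomial algebra $\Bbbk[X,Y]$ onto $Z(U^+)$ that sends $X$ to $z$ and $Y$ to $z'$). Moreover $z\in U_3$ and $z'\in U_4$. -/

import Mathlib

namespace UqB2

variable {k : Type*} [Field k]

/-- The defining relations (the quantum Serre relations of type `B₂`) on the free algebra on two
generators `E₁ = ι 0` and `E₂ = ι 1`, for the Cartan matrix `(2, -1; -2, 2)` and
`(d₁, d₂) = (2, 1)`. -/
inductive SerreRel (q : k) : FreeAlgebra k (Fin 2) → FreeAlgebra k (Fin 2) → Prop
  | s1 : SerreRel q
      (FreeAlgebra.ι k 0 ^ 2 * FreeAlgebra.ι k 1 + FreeAlgebra.ι k 1 * FreeAlgebra.ι k 0 ^ 2)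
      ((q ^ 2 + (q ^ 2)⁻¹) • (FreeAlgebra.ι k 0 * FreeAlgebra.ι k 1 * FreeAlgebra.ι k 0))
  | s2 : SerreRel q
      (FreeAlgebra.ι k 1 ^ 3 * FreeAlgebra.ι k 0
        + (q ^ 2 + 1 + (q ^ 2)⁻¹) •
            (FreeAlgebra.ι k 1 * FreeAlgebra.ι k 0 * FreeAlgebra.ι k 1 ^ 2))
      ((q ^ 2 + 1 + (q ^ 2)⁻¹) •
            (FreeAlgebra.ι k 1 ^ 2 * FreeAlgebra.ι k 0 * FreeAlgebra.ι k 1)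
        + FreeAlgebra.ι k 0 * FreeAlgebra.ι k 1 ^ 3)

/-- The algebra `U⁺ = U_q⁺(B₂)`. -/
def UPlus (q : k) : Type _ := RingQuot (SerreRel q)

noncomputable instance instRing (q : k) : Ring (UPlus q) :=
  inferInstanceAs (Ring (RingQuot (SerreRel q)))

noncomputable instance instAlgebra (q : k) : Algebra k (UPlus q) :=
  inferInstanceAs (Algebra k (RingQuot (SerreRel q)))

/-- The quotient map from the free algebra. -/
noncomputable def mk (q : k) : FreeAlgebra k (Fin 2) →ₐ[k] UPlus q :=
  RingQuot.mkAlgHom k (SerreRel q)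

/-- The generator `e₁`. -/
noncomputable def e₁ (q : k) : UPlus q := mk q (FreeAlgebra.ι k 0)

/-- The generator `e₂`. -/
noncomputable def e₂ (q : k) : UPlus q := mk q (FreeAlgebra.ι k 1)

/-- `e₃ = e₁ e₂ - q² e₂ e₁`. -/
noncomputable def e₃ (q : k) : UPlus q := e₁ q * e₂ q - q ^ 2 • (e₂ q * e₁ q)

/-- `z = e₂ e₃ - q² e₃ e₂`. -/
noncomputable def z (q : k) : UPlus q := e₂ q * e₃ q - q ^ 2 • (e₃ q * e₂ q)

/-- `w = e₂ e₃ - e₃ e₂`. -/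
noncomputable def w (q : k) : UPlus q := e₂ q * e₃ q - e₃ q * e₂ q

/-- `z' = e₁ w - q⁻⁴ w e₁`. -/
noncomputable def z' (q : k) : UPlus q := e₁ q * w q - (q ^ 4)⁻¹ • (w q * e₁ q)

/-- The homogeneous component `U_n` of the canonical grading of `U⁺`, in which `e₁` and `e₂` have
degree one: the span of the words of length `n` in `e₁` and `e₂`. -/
noncomputable def component (q : k) (n : ℕ) : Submodule k (UPlus q) :=
  Submodule.span k {e₁ q, e₂ q} ^ n

/-- An element `a` of an algebra `A` is normal (normalizing) if `a A = A a`. -/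
def IsNormalElement {A : Type*} [Mul A] (a : A) : Prop :=
  Set.range (fun b : A => a * b) = Set.range (fun b : A => b * a)

theorem mk_rel {q : k} {x y : FreeAlgebra k (Fin 2)} (h : SerreRel q x y) : mk q x = mk q y :=
  RingQuot.mkAlgHom_rel k h

/-- The universal property of `U⁺`. -/
noncomputable def lift (q : k) {A : Type*} [Semiring A] [Algebra k A]
    (f : FreeAlgebra k (Fin 2) →ₐ[k] A) (hf : ∀ ⦃x y⦄, SerreRel q x y → f x = f y) :
    UPlus q →ₐ[k] A :=
  RingQuot.liftAlgHom k ⟨f, hf⟩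

theorem lift_mk (q : k) {A : Type*} [Semiring A] [Algebra k A]
    (f : FreeAlgebra k (Fin 2) →ₐ[k] A) (hf : ∀ ⦃x y⦄, SerreRel q x y → f x = f y)
    (x : FreeAlgebra k (Fin 2)) : lift q f hf (mk q x) = f x :=
  RingQuot.liftAlgHom_mkAlgHom_apply k f hf x

theorem hom_ext {q : k} {A : Type*} [Semiring A] [Algebra k A] {f g : UPlus q →ₐ[k] A}
    (h₁ : f (e₁ q) = g (e₁ q)) (h₂ : f (e₂ q) = g (e₂ q)) : f = g := by
  refine RingQuot.ringQuot_ext' k f g ?_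
  apply FreeAlgebra.hom_ext
  funext i
  fin_cases i
  · exact h₁
  · exact h₂

theorem s1_eq (q : k) : e₁ q ^ 2 * e₂ q + e₂ q * e₁ q ^ 2
    = (q ^ 2 + (q ^ 2)⁻¹) • (e₁ q * e₂ q * e₁ q) := by
  have h := mk_rel (SerreRel.s1 (q := q))
  simpa only [e₁, e₂, map_add, map_mul, map_pow, map_smul] using h

theorem s2_eq (q : k) : e₂ q ^ 3 * e₁ q
    + (q ^ 2 + 1 + (q ^ 2)⁻¹) • (e₂ q * e₁ q * e₂ q ^ 2)
    = (q ^ 2 + 1 + (q ^ 2)⁻¹) • (e₂ q ^ 2 * e₁ q * e₂ q) + e₁ q * e₂ q ^ 3 := by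
  have h := mk_rel (SerreRel.s2 (q := q))
  simpa only [e₁, e₂, map_add, map_mul, map_pow, map_smul] using h

theorem e₁_mem (q : k) : e₁ q ∈ component q 1 := by
  rw [component, pow_one]; exact Submodule.subset_span (by simp)

theorem e₂_mem (q : k) : e₂ q ∈ component q 1 := by
  rw [component, pow_one]; exact Submodule.subset_span (by simp)

instance gradedMonoid (q : k) : SetLike.GradedMonoid (component q) :=
  Submodule.nat_power_gradedMonoid (Submodule.span k {e₁ q, e₂ q})

/-- The algebra map `U⁺ → ⨁ U_n` placing `e₁` and `e₂` in degree one. -/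
noncomputable def toGraded (q : k) : UPlus q →ₐ[k] DirectSum ℕ (fun n => component q n) :=
  lift q (FreeAlgebra.lift k
    ![DirectSum.of (fun n => component q n) 1 ⟨e₁ q, e₁_mem q⟩,
      DirectSum.of (fun n => component q n) 1 ⟨e₂ q, e₂_mem q⟩]) (by
    rintro _ _ (_ | _)
    · have h := s1_eq q
      simp only [pow_succ, pow_zero, one_mul] at h
      simp only [map_add, map_smul, map_mul, map_pow, FreeAlgebra.lift_ι_apply]
      generalize hc : q ^ 2 + (q ^ 2)⁻¹ = c
      simp only [pow_succ, pow_zero, one_mul] at hc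
      rw [hc] at h
      simp only [pow_succ, pow_zero, one_mul, Matrix.cons_val_zero,
        Matrix.cons_val_one, DirectSum.of_mul_of]
      simp only [← DirectSum.lof_eq_of k, ← map_smul]
      refine (map_add (DirectSum.lof k ℕ (fun n => component q n) _) _ _).symm.trans
        (Eq.trans ?_ rfl)
      exact congrArg _ (Subtype.ext h)
    · have h := s2_eq q
      simp only [pow_succ, pow_zero, one_mul] at h
      simp only [map_add, map_smul, map_mul, map_pow, FreeAlgebra.lift_ι_apply]
      generalize hc : q ^ 2 + 1 + (q ^ 2)⁻¹ = c
      simp only [pow_succ, pow_zero, one_mul] at hc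
      rw [hc] at h
      simp only [pow_succ, pow_zero, one_mul, Matrix.cons_val_zero,
        Matrix.cons_val_one, DirectSum.of_mul_of]
      simp only [← DirectSum.lof_eq_of k, ← map_smul]
      refine (map_add (DirectSum.lof k ℕ (fun n => component q n) _) _ _).symm.trans
        (Eq.trans ?_ (map_add (DirectSum.lof k ℕ (fun n => component q n) _) _ _))
      exact congrArg _ (Subtype.ext h))

theorem toGraded_e₁ (q : k) : toGraded q (e₁ q) =
    DirectSum.of (fun n => component q n) 1 ⟨e₁ q, e₁_mem q⟩ := by
  exact (lift_mk q _ _ _).trans (FreeAlgebra.lift_ι_apply _ _)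

theorem toGraded_e₂ (q : k) : toGraded q (e₂ q) =
    DirectSum.of (fun n => component q n) 1 ⟨e₂ q, e₂_mem q⟩ := by
  exact (lift_mk q _ _ _).trans (FreeAlgebra.lift_ι_apply _ _)

/-- The components `U_n` form an algebra grading of `U⁺`. -/
noncomputable instance gradedAlgebra (q : k) : GradedAlgebra (component q) :=
  GradedAlgebra.ofAlgHom _ (toGraded q)
    (by
      apply hom_ext
      · change DirectSum.coeAlgHom (component q) (toGraded q (e₁ q)) = e₁ q
        rw [toGraded_e₁, DirectSum.coeAlgHom_of]
      · change DirectSum.coeAlgHom (component q) (toGraded q (e₂ q)) = e₂ q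
        rw [toGraded_e₂, DirectSum.coeAlgHom_of])
    fun i x => by
      obtain ⟨x, hx⟩ := x
      dsimp only [Subtype.coe_mk]
      induction hx using Submodule.pow_induction_on_left' with
      | algebraMap r =>
        rw [AlgHom.commutes, DirectSum.algebraMap_apply]; rfl
      | add x y i hx hy ihx ihy =>
        rw [map_add, ihx, ihy, ← map_add]; rfl
      | mem_mul m hm i x hx ih =>
        have key : ∀ hm' : m ∈ component q 1, toGraded q m =
            DirectSum.of (fun n => component q n) 1 ⟨m, hm'⟩ := by
          induction hm using Submodule.span_induction with
          | mem m h =>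
            intro hm'
            rcases h with rfl | h
            · exact toGraded_e₁ q
            · obtain rfl : m = e₂ q := h
              exact toGraded_e₂ q
          | zero => intro _; rw [map_zero]; exact (map_zero _).symm
          | add a b ha hb iha ihb =>
            intro _
            have ha' : a ∈ component q 1 := by rwa [component, pow_one]
            have hb' : b ∈ component q 1 := by rwa [component, pow_one]
            rw [map_add, iha ha', ihb hb', ← map_add]; rfl
          | smul r a ha iha =>
            intro _
            have ha' : a ∈ component q 1 := by rwa [component, pow_one]
            rw [map_smul, iha ha', ← DirectSum.lof_eq_of k, ← map_smul]; rfl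
        have hm' : m ∈ component q 1 := by rwa [component, pow_one]
        rw [map_mul, ih, key hm', DirectSum.of_mul_of]
        exact DirectSum.of_eq_of_gradedMonoid_eq (Sigma.subtype_ext (add_comm _ _) rfl)

end UqB2

/-!
`U⁺` embeds into the quantum torus `k[z, z']⟨x^±1, y^±1⟩`, `y x = q² x y`, by
`e₁ ↦ (z' - x²) y⁻¹` and `e₂ ↦ x⁻¹ (y - z)`; up to nonzero scalars `e₃ ↦ x`, `w ↦ y`, `z ↦ z` and
`z' ↦ z'`. The map is injective because the images of the spanning monomials `z^a e₃^b e₂^c e₁^d`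
have distinct leading exponents.

Let `f ≠ 0` be normal. Conjugation by `f` sends `x` and `y` to multiples of themselves, so all
terms of `f` have the same degree `i` in `x` and the same degree `j` in `y`. Conjugation by `f`
therefore rescales each of the two terms of the image of `e₁`, and likewise of `e₂`. Since the
image of `U⁺` contains neither `x² y⁻¹` nor `x⁻¹ z`, the two scalars agree in both cases, which
gives `j = 0` and `i = 0`. Hence `f` is a polynomial in the central elements `z` and `z'`.
-/

theorem sq_ne_one_of_pow_four_ne_one {M : Type*} [Monoid M] {x : M} (h : x ^ 4 ≠ 1) : x ^ 2 ≠ 1 :=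
  fun h2 => h (by rw [pow_mul x 2 2, h2, one_pow])

theorem val_pow_ne_one_of_not_isOfFinOrder {M : Type*} [Monoid M] {u : Mˣ} (hu : ¬IsOfFinOrder u)
    {n : ℕ} (hn : 0 < n) : (u : M) ^ n ≠ 1 := fun h =>
  hu (Units.isOfFinOrder_val.1 (isOfFinOrder_iff_pow_eq_one.2 ⟨n, hn, h⟩))

theorem zpow_two_mul_inj_of_not_isOfFinOrder {G : Type*} [Group G] {g : G} (hg : ¬IsOfFinOrder g)
    {i j : ℤ} : g ^ (2 * i) = g ^ (2 * j) ↔ i = j := by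
  rw [(injective_zpow_iff_not_isOfFinOrder.2 hg).eq_iff]
  omega

theorem mul_mem_of_mem_adjoin {k A : Type*} [CommSemiring k] [Semiring A] [Algebra k A] {s : Set A}
    {V : Submodule k A} (hs : ∀ x ∈ s, ∀ v ∈ V, x * v ∈ V) {x : A} (hx : x ∈ Algebra.adjoin k s) :
    ∀ v ∈ V, x * v ∈ V := by
  induction hx using Algebra.adjoin_induction with
  | mem x hx => exact hs x hx
  | algebraMap r => exact fun v hv => by rw [← Algebra.smul_def]; exact V.smul_mem r hv
  | add x y _ _ hx hy => exact fun v hv => by rw [add_mul]; exact V.add_mem (hx v hv) (hy v hv)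
  | mul x y _ _ hx hy => exact fun v hv => by rw [mul_assoc]; exact hx _ (hy v hv)

theorem mul_mem_span_range {k A ι : Type*} [CommSemiring k] [Semiring A] [Algebra k A] {v : ι → A}
    {x : A} (hx : ∀ i, x * v i ∈ Submodule.span k (Set.range v)) :
    ∀ y ∈ Submodule.span k (Set.range v), x * y ∈ Submodule.span k (Set.range v) := by
  change Submodule.span k (Set.range v) ≤ (Submodule.span k _).comap (LinearMap.mulLeft k x)
  rw [Submodule.span_le]
  rintro _ ⟨i, rfl⟩
  exact hx i

/-- The element `g` is the conjugate `c • u - d • v` of `u - v` by `f`. -/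
theorem eq_of_mul_sub_mem {K B : Type*} [Field K] [Ring B] [NoZeroDivisors B] [Algebra K B]
    {W : Submodule K B} {f g u v : B} {c d : K} (hf : f ≠ 0) (hu : f * u = c • (u * f))
    (hv : f * v = d • (v * f)) (hg : g * f = f * (u - v)) (hgW : g ∈ W) (huvW : u - v ∈ W)
    (hvW : v ∉ W) : c = d := by
  have hgeq : g = c • u - d • v := mul_right_cancel₀ hf <| by
    rw [hg, mul_sub, hu, hv, sub_mul, smul_mul_assoc, smul_mul_assoc]
  have hmem : (c - d) • v ∈ W := by
    have : (c - d) • v = g - c • (u - v) := by rw [hgeq]; module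
    exact this ▸ W.sub_mem hgW (W.smul_mem c huvW)
  by_contra hcd
  exact hvW ((W.smul_mem_iff (sub_ne_zero.2 hcd)).1 hmem)

theorem algebraicIndependent_of_linearIndependent {ι R A : Type*} [CommRing R] [CommRing A]
    [Algebra R A] {x : ι → A}
    (h : LinearIndependent R fun m : ι →₀ ℕ => m.prod fun i n => x i ^ n) :
    AlgebraicIndependent R x := by
  let b := MvPolynomial.basisMonomials ι R
  have heq : (MvPolynomial.aeval x).toLinearMap =
      Finsupp.linearCombination R (fun m : ι →₀ ℕ => m.prod fun i n => x i ^ n) ∘ₗ b.repr := by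
    refine b.ext fun m => ?_
    rw [LinearMap.comp_apply, LinearEquiv.coe_coe, b.repr_self, Finsupp.linearCombination_single,
      one_smul, AlgHom.toLinearMap_apply, MvPolynomial.coe_basisMonomials,
      MvPolynomial.aeval_monomial, map_one, one_mul]
  rw [algebraicIndependent_iff_injective_aeval]
  refine fun p p' hp => b.repr.injective (h ?_)
  exact (LinearMap.congr_fun heq p).symm.trans (hp.trans (LinearMap.congr_fun heq p'))

theorem exists_mvPolynomial_algEquiv_center {k A : Type*} [CommRing k] [Ring A] [Algebra k A]
    {x y : A} (hcenter : Subalgebra.center k A = Algebra.adjoin k {x, y})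
    (hli : LinearIndependent k fun m : Fin 2 →₀ ℕ => x ^ m 0 * y ^ m 1) :
    ∃ φ : MvPolynomial (Fin 2) k ≃ₐ[k] Subalgebra.center k A,
      (φ (MvPolynomial.X 0) : A) = x ∧ (φ (MvPolynomial.X 1) : A) = y := by
  have hx : x ∈ Subalgebra.center k A := hcenter ▸ Algebra.subset_adjoin (by simp)
  have hy : y ∈ Subalgebra.center k A := hcenter ▸ Algebra.subset_adjoin (by simp)
  let v : Fin 2 → Subalgebra.center k A := ![⟨x, hx⟩, ⟨y, hy⟩]
  have hv : AlgebraicIndependent k v := algebraicIndependent_of_linearIndependent <|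
    .of_comp (Subalgebra.center k A).val.toLinearMap <| by
      simpa [v, Function.comp_def, Finsupp.prod_fintype] using hli
  have hadjoin : Algebra.adjoin k (Set.range v) = ⊤ := by
    refine Subalgebra.map_injective (f := (Subalgebra.center k A).val) Subtype.val_injective ?_
    rw [AlgHom.map_adjoin, Algebra.map_top, Subalgebra.range_val, ← Set.range_comp]
    refine Eq.trans ?_ hcenter.symm
    congr
    ext a
    simp [v, eq_comm]
  exact ⟨hv.aevalEquiv.trans ((Subalgebra.equivOfEq _ _ hadjoin).trans Subalgebra.topEquiv),
    by simp [v], by simp [v]⟩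

/-- The monoid algebra of `G` over `R` with multiplication twisted by the bicharacter `β`: the
basis vectors multiply by `x^a x^b = β(a, b) x^(a+b)`. For `G = ℤⁿ` this is a quantum torus. -/
def TwistedMonoidAlgebra {G R : Type*} [AddMonoid G] [CommRing R]
    (_ : G →+ G →+ Additive Rˣ) : Type _ :=
  G →₀ R

namespace TwistedMonoidAlgebra

section Basic

variable {G R : Type*} [AddMonoid G] [CommRing R] {β : G →+ G →+ Additive Rˣ}

noncomputable instance : AddCommGroup (TwistedMonoidAlgebra β) :=
  inferInstanceAs (AddCommGroup (G →₀ R))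

noncomputable instance : Module R (TwistedMonoidAlgebra β) := inferInstanceAs (Module R (G →₀ R))

variable (β) in
/-- The monomial with exponent `a`, as a linear function of its coefficient. -/
noncomputable def mono (a : G) : R →ₗ[R] TwistedMonoidAlgebra β := Finsupp.lsingle a

/-- The coefficient at the exponent `a`. -/
noncomputable def coeff (a : G) : TwistedMonoidAlgebra β →ₗ[R] R := Finsupp.lapply a

/-- The finite set of exponents with nonzero coefficient. -/
def supp (f : TwistedMonoidAlgebra β) : Finset G := Finsupp.support f

theorem mem_supp {f : TwistedMonoidAlgebra β} {a : G} : a ∈ f.supp ↔ coeff a f ≠ 0 :=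
  Finsupp.mem_support_iff

theorem supp_nonempty {f : TwistedMonoidAlgebra β} : f.supp.Nonempty ↔ f ≠ 0 :=
  Finsupp.support_nonempty_iff

theorem supp_mono (a : G) {r : R} (hr : r ≠ 0) : (mono β a r).supp = {a} :=
  Finsupp.support_single _ hr

theorem ext_coeff {f g : TwistedMonoidAlgebra β} (h : ∀ a, coeff a f = coeff a g) : f = g :=
  Finsupp.ext h

theorem coeff_mono_self (a : G) (r : R) : coeff a (mono β a r) = r := Finsupp.single_eq_same

theorem coeff_mono_of_ne {a b : G} (h : b ≠ a) (r : R) : coeff b (mono β a r) = 0 :=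
  Finsupp.single_eq_of_ne h

theorem sum_supp (f : TwistedMonoidAlgebra β) : ∑ a ∈ f.supp, mono β a (coeff a f) = f :=
  Finsupp.sum_single f

@[elab_as_elim]
theorem induction_mono {p : TwistedMonoidAlgebra β → Prop} (f : TwistedMonoidAlgebra β)
    (zero : p 0) (add : ∀ f g, p f → p g → p (f + g)) (mono : ∀ a r, p (mono β a r)) : p f :=
  Finsupp.induction_linear f zero add mono

/-- The linear map with prescribed restrictions to the monomials. -/
noncomputable def lsum {M : Type*} [AddCommMonoid M] [Module R M] (φ : G → R →ₗ[R] M) :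
    TwistedMonoidAlgebra β →ₗ[R] M :=
  Finsupp.lsum R φ

theorem lsum_mono {M : Type*} [AddCommMonoid M] [Module R M] (φ : G → R →ₗ[R] M) (a : G) (r : R) :
    lsum φ (mono β a r) = φ a r :=
  Finsupp.lsum_single R φ a r

variable (β) in
/-- The multiplication of the twisted monoid algebra as a bilinear map. -/
noncomputable def mulHom :
    TwistedMonoidAlgebra β →ₗ[R] TwistedMonoidAlgebra β →ₗ[R] TwistedMonoidAlgebra β :=
  lsum fun a => LinearMap.flip <| lsum fun b =>
    ((β a b).toMul : R) • (LinearMap.mul R R).compr₂ (mono β (a + b))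

theorem mulHom_mono_mono (a b : G) (r s : R) :
    mulHom β (mono β a r) (mono β b s) = mono β (a + b) ((β a b).toMul * (r * s)) := by
  rw [mulHom, lsum_mono, LinearMap.flip_apply, lsum_mono, LinearMap.smul_apply,
    LinearMap.smul_apply, LinearMap.compr₂_apply, LinearMap.mul_apply_apply, ← map_smul,
    smul_eq_mul, mul_comm s]

noncomputable instance : Mul (TwistedMonoidAlgebra β) := ⟨fun f g => mulHom β f g⟩

noncomputable instance : One (TwistedMonoidAlgebra β) := ⟨mono β 0 1⟩

theorem one_def : (1 : TwistedMonoidAlgebra β) = mono β 0 1 := rfl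

theorem mul_def (f g : TwistedMonoidAlgebra β) : f * g = mulHom β f g := rfl

theorem mono_mul_mono (a b : G) (r s : R) :
    mono β a r * mono β b s = mono β (a + b) ((β a b).toMul * (r * s)) :=
  mulHom_mono_mono a b r s

theorem mulHom_one (f : TwistedMonoidAlgebra β) : mulHom β f (mono β 0 1) = f := by
  induction f using induction_mono with
  | zero => rw [map_zero, LinearMap.zero_apply]
  | add f g hf hg => rw [map_add, LinearMap.add_apply, hf, hg]
  | mono a r => simp [mulHom_mono_mono]

theorem one_mulHom (f : TwistedMonoidAlgebra β) : mulHom β (mono β 0 1) f = f := by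
  induction f using induction_mono with
  | zero => rw [map_zero]
  | add f g hf hg => rw [map_add, hf, hg]
  | mono a r => simp [mulHom_mono_mono]

theorem mulHom_assoc (f g h : TwistedMonoidAlgebra β) :
    mulHom β (mulHom β f g) h = mulHom β f (mulHom β g h) := by
  induction f using induction_mono with
  | zero => simp only [map_zero, LinearMap.zero_apply]
  | add f f' hf hf' => simp only [map_add, LinearMap.add_apply, hf, hf']
  | mono a r =>
    induction g using induction_mono with
    | zero => simp only [map_zero, LinearMap.zero_apply]
    | add g g' hg hg' => simp only [map_add, LinearMap.add_apply, hg, hg']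
    | mono b s =>
      induction h using induction_mono with
      | zero => simp only [map_zero]
      | add h h' hh hh' => simp only [map_add, hh, hh']
      | mono c t =>
        simp only [mulHom_mono_mono, map_add, AddMonoidHom.add_apply, add_assoc, toMul_add,
          Units.val_mul]
        congr 1
        ring

noncomputable instance : Ring (TwistedMonoidAlgebra β) :=
  { (inferInstance : AddCommGroup (TwistedMonoidAlgebra β)) with
    mul := (· * ·)
    one := 1
    left_distrib := fun f g h => map_add (mulHom β f) g h
    right_distrib := fun f g h => by simp only [mul_def, map_add, LinearMap.add_apply]
    zero_mul := fun f => by simp only [mul_def, map_zero, LinearMap.zero_apply]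
    mul_zero := fun f => map_zero (mulHom β f)
    mul_assoc := mulHom_assoc
    one_mul := one_mulHom
    mul_one := mulHom_one }

noncomputable instance : Algebra R (TwistedMonoidAlgebra β) :=
  Algebra.ofModule (fun r f g => by simp only [mul_def, map_smul, LinearMap.smul_apply])
    (fun r f g => by simp only [mul_def, map_smul])

theorem mul_eq_sum (f g : TwistedMonoidAlgebra β) :
    f * g = ∑ a ∈ f.supp, ∑ b ∈ g.supp,
      mono β (a + b) ((β a b).toMul * (coeff a f * coeff b g)) := by
  conv_lhs => rw [← sum_supp f, ← sum_supp g, Finset.sum_mul_sum]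
  simp only [mono_mul_mono]

theorem exists_of_mem_supp_mul {f g : TwistedMonoidAlgebra β} {c : G} (hc : c ∈ (f * g).supp) :
    ∃ a ∈ f.supp, ∃ b ∈ g.supp, a + b = c := by
  contrapose! hc
  rw [mem_supp, not_not, mul_eq_sum, map_sum]
  refine Finset.sum_eq_zero fun a ha => ?_
  rw [map_sum]
  exact Finset.sum_eq_zero fun b hb => coeff_mono_of_ne (hc a ha b hb).symm _

theorem coeff_mul_of_uniqueAdd {f g : TwistedMonoidAlgebra β} {a b : G} (ha : a ∈ f.supp)
    (hb : b ∈ g.supp) (h : UniqueAdd f.supp g.supp a b) :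
    coeff (a + b) (f * g) = (β a b).toMul * (coeff a f * coeff b g) := by
  have hne {c d : G} (hc : c ∈ f.supp) (hd : d ∈ g.supp) (hcd : ¬(c = a ∧ d = b)) (r : R) :
      coeff (a + b) (mono β (c + d) r) = 0 :=
    coeff_mono_of_ne (fun heq => hcd (h hc hd heq.symm)) r
  rw [mul_eq_sum, map_sum, Finset.sum_eq_single_of_mem a ha, map_sum,
    Finset.sum_eq_single_of_mem b hb, coeff_mono_self]
  · exact fun d hd hdb => hne ha hd (fun hcd => hdb hcd.2) _
  · intro c hc hca
    rw [map_sum]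
    exact Finset.sum_eq_zero fun d hd => hne hc hd (fun hcd => hca hcd.1) _

theorem add_mem_supp_mul_of_uniqueAdd [NoZeroDivisors R] {f g : TwistedMonoidAlgebra β} {a b : G}
    (ha : a ∈ f.supp) (hb : b ∈ g.supp) (h : UniqueAdd f.supp g.supp a b) :
    a + b ∈ (f * g).supp := by
  rw [mem_supp, coeff_mul_of_uniqueAdd ha hb h, ne_eq, Units.mul_right_eq_zero]
  exact mul_ne_zero (mem_supp.1 ha) (mem_supp.1 hb)

theorem mono_pow (a : G) (ha : β a a = 0) (r : R) (n : ℕ) :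
    mono β a r ^ n = mono β (n • a) (r ^ n) := by
  induction n with
  | zero => rw [pow_zero, zero_nsmul, pow_zero, one_def]
  | succ n ih =>
    have hn : β (n • a) a = 0 := by rw [map_nsmul, AddMonoidHom.nsmul_apply, ha, smul_zero]
    rw [pow_succ, ih, mono_mul_mono, hn, succ_nsmul, toMul_zero, Units.val_one, one_mul, pow_succ]

theorem coeff_add_mul_mono [IsRightCancelAdd G] (f : TwistedMonoidAlgebra β) (a b : G) (r : R) :
    coeff (b + a) (f * mono β a r) = (β b a).toMul * (coeff b f * r) := by
  induction f using induction_mono with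
  | zero => simp only [zero_mul, map_zero, mul_zero]
  | add f g hf hg => rw [add_mul, map_add, hf, hg, map_add]; ring
  | mono c s =>
    rw [mono_mul_mono]
    rcases eq_or_ne b c with rfl | hbc
    · simp only [coeff_mono_self]
    · rw [coeff_mono_of_ne hbc, coeff_mono_of_ne (mt add_right_cancel hbc), zero_mul, mul_zero]

theorem coeff_add_mono_mul [IsLeftCancelAdd G] (f : TwistedMonoidAlgebra β) (a b : G) (r : R) :
    coeff (a + b) (mono β a r * f) = (β a b).toMul * (r * coeff b f) := by
  induction f using induction_mono with
  | zero => simp only [mul_zero, map_zero]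
  | add f g hf hg => rw [mul_add, map_add, hf, hg, map_add]; ring
  | mono c s =>
    rw [mono_mul_mono]
    rcases eq_or_ne b c with rfl | hbc
    · simp only [coeff_mono_self]
    · rw [coeff_mono_of_ne hbc, coeff_mono_of_ne (mt add_left_cancel hbc), mul_zero, mul_zero]

end Basic

section Comm

variable {G R : Type*} [AddCommMonoid G] [CommRing R] {β : G →+ G →+ Additive Rˣ}

theorem mul_mono_eq_smul_mono_mul {f : TwistedMonoidAlgebra β} {a : G} {u : Rˣ}
    (h : ∀ b ∈ f.supp, (β b a).toMul = u * (β a b).toMul) (r : R) :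
    f * mono β a r = (u : R) • (mono β a r * f) := by
  rw [← sum_supp f, Finset.sum_mul, Finset.mul_sum, Finset.smul_sum]
  refine Finset.sum_congr rfl fun b hb => ?_
  rw [mono_mul_mono, mono_mul_mono, h b hb, ← map_smul, add_comm, smul_eq_mul,
    Units.val_mul, mul_assoc, mul_comm r]

end Comm

section LeadingTerm

variable {G R : Type*} [AddMonoid G] [LinearOrder G] [CommRing R] {β : G →+ G →+ Additive Rˣ}

theorem exists_isGreatest_supp {f : TwistedMonoidAlgebra β} (hf : f ≠ 0) :
    ∃ a, IsGreatest (f.supp : Set G) a :=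
  ⟨_, f.supp.isGreatest_max' (supp_nonempty.2 hf)⟩

theorem exists_isLeast_supp {f : TwistedMonoidAlgebra β} (hf : f ≠ 0) :
    ∃ a, IsLeast (f.supp : Set G) a :=
  ⟨_, f.supp.isLeast_min' (supp_nonempty.2 hf)⟩

theorem isGreatest_supp_mono (a : G) {r : R} (hr : r ≠ 0) :
    IsGreatest ((mono β a r).supp : Set G) a := by
  rw [supp_mono a hr, Finset.coe_singleton]
  exact isGreatest_singleton

theorem isLeast_supp_mono (a : G) {r : R} (hr : r ≠ 0) :
    IsLeast ((mono β a r).supp : Set G) a := by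
  rw [supp_mono a hr, Finset.coe_singleton]
  exact isLeast_singleton

theorem isGreatest_supp_mono_sub_mono {a b : G} (hba : b < a) {r : R} (hr : r ≠ 0) (s : R) :
    IsGreatest ((mono β a r - mono β b s).supp : Set G) a := by
  refine ⟨?_, fun c hc => ?_⟩
  · rw [Finset.mem_coe, mem_supp, map_sub, coeff_mono_self, coeff_mono_of_ne hba.ne', sub_zero]
    exact hr
  · by_contra hca
    rw [not_le] at hca
    rw [Finset.mem_coe, mem_supp, map_sub, coeff_mono_of_ne hca.ne',
      coeff_mono_of_ne (hba.trans hca).ne', sub_zero] at hc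
    exact hc rfl

variable [NoZeroDivisors R] {ι : Type*} {v : ι → TwistedMonoidAlgebra β} {d : ι → G}

theorem exists_isGreatest_supp_linearCombination (hd : d.Injective)
    (hv : ∀ i, IsGreatest ((v i).supp : Set G) (d i)) {c : ι →₀ R} (hc : c ≠ 0) :
    ∃ i, IsGreatest ((Finsupp.linearCombination R v c).supp : Set G) (d i) := by
  obtain ⟨i, hi, hmax⟩ := c.support.exists_max_image d (Finsupp.support_nonempty_iff.2 hc)
  have hcoeff (a : G) : coeff a (Finsupp.linearCombination R v c)
      = ∑ j ∈ c.support, c j * coeff a (v j) := by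
    simp only [Finsupp.linearCombination_apply, Finsupp.sum, map_sum, map_smul, smul_eq_mul]
  refine ⟨i, ?_, fun a ha => ?_⟩
  · rw [Finset.mem_coe, mem_supp, hcoeff, Finset.sum_eq_single_of_mem i hi]
    · exact mul_ne_zero (Finsupp.mem_support_iff.1 hi) (mem_supp.1 (hv i).1)
    · intro j hj hji
      have hlt : d j < d i := (hmax j hj).lt_of_ne (hd.ne hji)
      rw [not_not.1 (mt mem_supp.2 fun h => hlt.not_ge ((hv j).2 h)), mul_zero]
  · rw [Finset.mem_coe, mem_supp, hcoeff] at ha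
    obtain ⟨j, hj, hne⟩ := Finset.exists_ne_zero_of_sum_ne_zero ha
    exact ((hv j).2 (mem_supp.2 (right_ne_zero_of_mul hne))).trans (hmax j hj)

theorem linearIndependent_of_isGreatest_supp (hd : d.Injective)
    (hv : ∀ i, IsGreatest ((v i).supp : Set G) (d i)) : LinearIndependent R v := by
  rw [linearIndependent_iff]
  intro c hc
  by_contra hne
  obtain ⟨i, hi⟩ := exists_isGreatest_supp_linearCombination hd hv hne
  exact supp_nonempty.1 ⟨d i, hi.1⟩ hc

end LeadingTerm

section Ordered

variable {G R : Type*} [AddCommMonoid G] [LinearOrder G] [IsOrderedCancelAddMonoid G]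

theorem uniqueAdd_of_isGreatest {s t : Finset G} {a b : G} (ha : IsGreatest (s : Set G) a)
    (hb : IsGreatest (t : Set G) b) : UniqueAdd s t a b :=
  fun _ _ hc hd h => (add_eq_add_iff_eq_and_eq (ha.2 hc) (hb.2 hd)).1 h

theorem uniqueAdd_of_isLeast {s t : Finset G} {a b : G} (ha : IsLeast (s : Set G) a)
    (hb : IsLeast (t : Set G) b) : UniqueAdd s t a b := fun _ _ hc hd h =>
  ((add_eq_add_iff_eq_and_eq (ha.2 hc) (hb.2 hd)).1 h.symm).imp Eq.symm Eq.symm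

variable [CommRing R] [NoZeroDivisors R] {β : G →+ G →+ Additive Rˣ}
  {f g : TwistedMonoidAlgebra β} {a b : G}

theorem isGreatest_supp_mul (ha : IsGreatest (f.supp : Set G) a)
    (hb : IsGreatest (g.supp : Set G) b) : IsGreatest ((f * g).supp : Set G) (a + b) := by
  refine ⟨add_mem_supp_mul_of_uniqueAdd ha.1 hb.1 (uniqueAdd_of_isGreatest ha hb), fun c hc => ?_⟩
  obtain ⟨a', ha', b', hb', rfl⟩ := exists_of_mem_supp_mul hc
  exact add_le_add (ha.2 ha') (hb.2 hb')

theorem isLeast_supp_mul (ha : IsLeast (f.supp : Set G) a)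
    (hb : IsLeast (g.supp : Set G) b) : IsLeast ((f * g).supp : Set G) (a + b) := by
  refine ⟨add_mem_supp_mul_of_uniqueAdd ha.1 hb.1 (uniqueAdd_of_isLeast ha hb), fun c hc => ?_⟩
  obtain ⟨a', ha', b', hb', rfl⟩ := exists_of_mem_supp_mul hc
  exact add_le_add (ha.2 ha') (hb.2 hb')

instance : NoZeroDivisors (TwistedMonoidAlgebra β) where
  eq_zero_or_eq_zero_of_mul_eq_zero {f g} h := by
    contrapose! h
    obtain ⟨a, ha⟩ := exists_isGreatest_supp h.1
    obtain ⟨b, hb⟩ := exists_isGreatest_supp h.2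
    exact supp_nonempty.1 ⟨_, (isGreatest_supp_mul ha hb).1⟩

theorem isGreatest_supp_pow [Nontrivial R] (ha : IsGreatest (f.supp : Set G) a) (n : ℕ) :
    IsGreatest ((f ^ n).supp : Set G) (n • a) := by
  induction n with
  | zero => rw [pow_zero, zero_nsmul, one_def]; exact isGreatest_supp_mono 0 one_ne_zero
  | succ n ih => rw [pow_succ, succ_nsmul]; exact isGreatest_supp_mul ih ha

theorem eq_mono_of_mul_eq_mul_mono (hf : f ≠ 0) {r : R} (hr : r ≠ 0)
    (h : g * f = f * mono β a r) : g = mono β a (coeff a g) := by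
  have hg : g ≠ 0 := by
    rintro rfl
    rw [zero_mul] at h
    exact mul_ne_zero hf (supp_nonempty.1 ⟨a, (isGreatest_supp_mono a hr).1⟩) h.symm
  obtain ⟨m, hm⟩ := exists_isGreatest_supp hf
  obtain ⟨m', hm'⟩ := exists_isGreatest_supp hg
  obtain ⟨l, hl⟩ := exists_isLeast_supp hf
  obtain ⟨l', hl'⟩ := exists_isLeast_supp hg
  have hm'a : m' = a := add_right_cancel <| ((h ▸ isGreatest_supp_mul hm' hm).unique
    (isGreatest_supp_mul hm (isGreatest_supp_mono a hr))).trans (add_comm m a)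
  have hl'a : l' = a := add_right_cancel <| ((h ▸ isLeast_supp_mul hl' hl).unique
    (isLeast_supp_mul hl (isLeast_supp_mono a hr))).trans (add_comm l a)
  refine ext_coeff fun c => ?_
  by_cases hc : c ∈ g.supp
  · obtain rfl : c = a := le_antisymm (hm'a ▸ hm'.2 hc) (hl'a ▸ hl'.2 hc)
    rw [coeff_mono_self]
  · rw [not_not.1 (mt mem_supp.2 hc), coeff_mono_of_ne]
    rintro rfl
    exact hc (hm'a ▸ hm'.1)

/-- All terms of `f` commute with the monomial `x^a` up to the same factor. -/
theorem toMul_mul_eq_of_mul_eq_mul_mono {r : R} (hr : r ≠ 0) (h : g * f = f * mono β a r) {b c : G}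
    (hb : b ∈ f.supp) (hc : c ∈ f.supp) :
    (β b a).toMul * (β a c).toMul = (β c a).toMul * (β a b).toMul := by
  set s := coeff a g
  have hg : g = mono β a s := eq_mono_of_mul_eq_mul_mono (supp_nonempty.1 ⟨b, hb⟩) hr h
  have key {e : G} (he : e ∈ f.supp) : ((β a e).toMul : R) * s = (β e a).toMul * r := by
    have := coeff_add_mul_mono f a e r
    rw [← h, hg, add_comm, coeff_add_mono_mul] at this
    exact mul_right_cancel₀ (mem_supp.1 he) (by linear_combination this)
  refine Units.ext (mul_right_cancel₀ hr ?_)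
  push_cast
  linear_combination (β a b).toMul * key hc - (β a c).toMul * key hb

end Ordered

end TwistedMonoidAlgebra

namespace UqB2

section Relations

variable {k : Type*} [Field k] (q : k)

theorem adjoin_eq_top : Algebra.adjoin k {e₁ q, e₂ q} = ⊤ := by
  have hmk : Function.Surjective (mk q) := RingQuot.mkAlgHom_surjective k (SerreRel q)
  rw [← (AlgHom.range_eq_top (mk q)).2 hmk, ← Algebra.map_top, ← FreeAlgebra.adjoin_range_ι,
    AlgHom.map_adjoin, ← Set.range_comp]
  congr
  ext f
  simp [e₁, e₂, eq_comm]

theorem e₃_mem_component : e₃ q ∈ component q 2 :=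
  Submodule.sub_mem _ (SetLike.mul_mem_graded (e₁_mem q) (e₂_mem q))
    (Submodule.smul_mem _ _ (SetLike.mul_mem_graded (e₂_mem q) (e₁_mem q)))

theorem z_mem_component : z q ∈ component q 3 :=
  Submodule.sub_mem _ (SetLike.mul_mem_graded (e₂_mem q) (e₃_mem_component q))
    (Submodule.smul_mem _ _ (SetLike.mul_mem_graded (e₃_mem_component q) (e₂_mem q)))

theorem w_mem_component : w q ∈ component q 3 :=
  Submodule.sub_mem _ (SetLike.mul_mem_graded (e₂_mem q) (e₃_mem_component q))
    (SetLike.mul_mem_graded (e₃_mem_component q) (e₂_mem q))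

theorem z'_mem_component : z' q ∈ component q 4 :=
  Submodule.sub_mem _ (SetLike.mul_mem_graded (e₁_mem q) (w_mem_component q))
    (Submodule.smul_mem _ _ (SetLike.mul_mem_graded (w_mem_component q) (e₁_mem q)))

theorem e₁_mul_e₂ : e₁ q * e₂ q = q ^ 2 • (e₂ q * e₁ q) + e₃ q := by
  rw [e₃, add_sub_cancel]

theorem e₂_mul_e₃ : e₂ q * e₃ q = q ^ 2 • (e₃ q * e₂ q) + z q := by
  rw [z, add_sub_cancel]

variable {q}

theorem e₁_mul_e₃ (hq : q ≠ 0) : e₁ q * e₃ q = (q ^ 2)⁻¹ • (e₃ q * e₁ q) := by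
  have h := s1_eq q
  simp only [e₃, mul_sub, sub_mul, mul_smul_comm, smul_mul_assoc, mul_assoc, pow_succ, pow_zero,
    one_mul] at h ⊢
  linear_combination (norm := skip) h
  match_scalars <;> field_simp <;> ring

theorem e₂_mul_z (hq : q ≠ 0) : e₂ q * z q = z q * e₂ q := by
  have h := s2_eq q
  simp only [z, e₃, mul_sub, sub_mul, mul_smul_comm, smul_mul_assoc, mul_assoc, pow_succ, pow_zero,
    one_mul] at h ⊢
  linear_combination (norm := skip) (-q ^ 2) • h
  match_scalars <;> field_simp <;> ring

theorem e₁_mul_z (hq : q ≠ 0) : e₁ q * z q = z q * e₁ q := by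
  have h₁₃ := e₁_mul_e₃ hq
  have h₁₂ := e₁_mul_e₂ q
  have h₁₂' (x : UPlus q) := congrArg (· * x) h₁₂
  have h₁₃' (x : UPlus q) := congrArg (· * x) h₁₃
  simp only [mul_assoc] at h₁₂' h₁₃'
  simp only [z, mul_sub, sub_mul, mul_smul_comm, smul_mul_assoc, h₁₂, h₁₃, mul_assoc, h₁₂', h₁₃',
    add_mul, mul_add, smul_add]
  match_scalars <;> field_simp
  ring

theorem z_mem_center (hq : q ≠ 0) : z q ∈ Subalgebra.center k (UPlus q) := by
  refine Subalgebra.mem_center_iff.2 fun f => ?_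
  have hf : f ∈ Algebra.adjoin k {e₁ q, e₂ q} := adjoin_eq_top q ▸ Algebra.mem_top
  refine (Algebra.commute_of_mem_adjoin_of_forall_mem_commute hf ?_).symm.eq
  rintro _ (rfl | rfl)
  exacts [(e₁_mul_z hq).symm, (e₂_mul_z hq).symm]

variable (q) in
/-- The ordered (Poincaré–Birkhoff–Witt) monomial with exponents `(a, b, c, d)` in `z, e₃, e₂, e₁`;
these monomials span `U⁺`. -/
noncomputable def pbw (s : ℕ × ℕ × ℕ × ℕ) : UPlus q :=
  z q ^ s.1 * (e₃ q ^ s.2.1 * (e₂ q ^ s.2.2.1 * e₁ q ^ s.2.2.2))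

theorem z_mul_pbw (a b c d : ℕ) : z q * pbw q (a, b, c, d) = pbw q (a + 1, b, c, d) := by
  simp only [pbw, pow_succ', mul_assoc]

theorem e₃_mul_pbw (hq : q ≠ 0) (a b c d : ℕ) :
    e₃ q * pbw q (a, b, c, d) = pbw q (a, b + 1, c, d) := by
  have hz := Subalgebra.mem_center_iff.1 (pow_mem (z_mem_center hq) a) (e₃ q)
  simp only [pbw, ← mul_assoc, hz]
  simp only [pow_succ', mul_assoc]

theorem e₂_mul_pbw_zero (hq : q ≠ 0) (a c d : ℕ) :
    e₂ q * pbw q (a, 0, c, d) = pbw q (a, 0, c + 1, d) := by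
  have hz := Subalgebra.mem_center_iff.1 (pow_mem (z_mem_center hq) a) (e₂ q)
  simp only [pbw, pow_zero, one_mul, ← mul_assoc, hz]
  simp only [pow_succ', mul_assoc]

theorem e₂_mul_pbw_succ (hq : q ≠ 0) (a b c d : ℕ) : e₂ q * pbw q (a, b + 1, c, d) =
    q ^ 2 • (e₃ q * (e₂ q * pbw q (a, b, c, d))) + pbw q (a + 1, b, c, d) := by
  rw [← e₃_mul_pbw hq, ← mul_assoc, e₂_mul_e₃, add_mul, smul_mul_assoc, mul_assoc, z_mul_pbw]

theorem e₁_mul_pbw_zero_zero (hq : q ≠ 0) (a d : ℕ) :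
    e₁ q * pbw q (a, 0, 0, d) = pbw q (a, 0, 0, d + 1) := by
  have hz := Subalgebra.mem_center_iff.1 (pow_mem (z_mem_center hq) a) (e₁ q)
  simp only [pbw, pow_zero, one_mul, ← mul_assoc, hz]
  simp only [pow_succ', mul_assoc]

theorem e₁_mul_pbw_zero_succ (hq : q ≠ 0) (a c d : ℕ) : e₁ q * pbw q (a, 0, c + 1, d) =
    q ^ 2 • (e₂ q * (e₁ q * pbw q (a, 0, c, d))) + pbw q (a, 1, c, d) := by
  rw [← e₂_mul_pbw_zero hq, ← mul_assoc, e₁_mul_e₂, add_mul, smul_mul_assoc, mul_assoc,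
    e₃_mul_pbw hq]

theorem e₁_mul_pbw_succ (hq : q ≠ 0) (a b c d : ℕ) :
    e₁ q * pbw q (a, b + 1, c, d) = (q ^ 2)⁻¹ • (e₃ q * (e₁ q * pbw q (a, b, c, d))) := by
  rw [← e₃_mul_pbw hq, ← mul_assoc, e₁_mul_e₃ hq, smul_mul_assoc, mul_assoc]

local notation "V" => Submodule.span k (Set.range (pbw q))

theorem pbw_mem_span (s : ℕ × ℕ × ℕ × ℕ) : pbw q s ∈ V := Submodule.subset_span ⟨s, rfl⟩

theorem e₃_mul_mem_span_pbw (hq : q ≠ 0) : ∀ f ∈ V, e₃ q * f ∈ V :=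
  mul_mem_span_range fun (a, b, c, d) => e₃_mul_pbw hq a b c d ▸ pbw_mem_span _

theorem e₂_mul_mem_span_pbw (hq : q ≠ 0) : ∀ f ∈ V, e₂ q * f ∈ V := by
  refine mul_mem_span_range fun (a, b, c, d) => ?_
  induction b with
  | zero => rw [e₂_mul_pbw_zero hq]; exact pbw_mem_span _
  | succ b ih =>
    rw [e₂_mul_pbw_succ hq]
    exact add_mem (Submodule.smul_mem _ _ (e₃_mul_mem_span_pbw hq _ ih)) (pbw_mem_span _)

theorem e₁_mul_mem_span_pbw (hq : q ≠ 0) : ∀ f ∈ V, e₁ q * f ∈ V := by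
  refine mul_mem_span_range fun (a, b, c, d) => ?_
  induction b with
  | zero =>
    induction c with
    | zero => rw [e₁_mul_pbw_zero_zero hq]; exact pbw_mem_span _
    | succ c ih =>
      rw [e₁_mul_pbw_zero_succ hq]
      exact add_mem (Submodule.smul_mem _ _ (e₂_mul_mem_span_pbw hq _ ih)) (pbw_mem_span _)
  | succ b ih =>
    rw [e₁_mul_pbw_succ hq]
    exact Submodule.smul_mem _ _ (e₃_mul_mem_span_pbw hq _ ih)

theorem span_pbw (hq : q ≠ 0) : Submodule.span k (Set.range (pbw q)) = ⊤ := by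
  refine eq_top_iff.2 fun f _ => ?_
  have hone : (1 : UPlus q) ∈ V := by simpa [pbw] using pbw_mem_span (q := q) (0, 0, 0, 0)
  have hf : f ∈ Algebra.adjoin k {e₁ q, e₂ q} := adjoin_eq_top q ▸ Algebra.mem_top
  refine mul_one f ▸ mul_mem_of_mem_adjoin ?_ hf 1 hone
  rintro _ (rfl | rfl)
  exacts [e₁_mul_mem_span_pbw hq, e₂_mul_mem_span_pbw hq]

end Relations

end UqB2

namespace UqB2

open TwistedMonoidAlgebra

section Torus

variable {k : Type*} [Field k]

/-- Exponents of the monomials `x^i y^j z^m z'^n`, stored as `(n, j, i, m)` so that the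
lexicographic order gives distinct leading exponents to the images of the monomials `pbw`. -/
abbrev Exponent : Type := ℕ ×ₗ ℤ ×ₗ ℤ ×ₗ ℕ

/-- The exponent of `x^i y^j z^m z'^n`. -/
def expo (i j : ℤ) (m n : ℕ) : Exponent := toLex (n, toLex (j, toLex (i, m)))

theorem expo_add_expo (i j i' j' : ℤ) (m n m' n' : ℕ) :
    expo i j m n + expo i' j' m' n' = expo (i + i') (j + j') (m + m') (n + n') := rfl

theorem nsmul_expo (i j : ℤ) (m n c : ℕ) :
    c • expo i j m n = expo (c * i) (c * j) (c * m) (c * n) := by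
  change toLex (c • n, toLex (c • j, toLex (c • i, c • m))) = _
  simp only [expo, nsmul_eq_mul, Nat.cast_id]

theorem expo_inj {i j i' j' : ℤ} {m n m' n' : ℕ} :
    expo i j m n = expo i' j' m' n' ↔ i = i' ∧ j = j' ∧ m = m' ∧ n = n' := by
  simp only [expo, toLex_inj, Prod.mk.injEq]
  tauto

theorem expo_lt_expo {i j i' j' : ℤ} {m n m' n' : ℕ} : expo i j m n < expo i' j' m' n' ↔
    n < n' ∨ n = n' ∧ (j < j' ∨ j = j' ∧ (i < i' ∨ i = i' ∧ m < m')) := by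
  simp only [expo, Prod.Lex.toLex_lt_toLex]

/-- The degree in `x`. -/
def xDeg : Exponent →+ ℤ where
  toFun a := (ofLex (ofLex (ofLex a).2).2).1
  map_zero' := rfl
  map_add' _ _ := rfl

/-- The degree in `y`. -/
def yDeg : Exponent →+ ℤ where
  toFun a := (ofLex (ofLex a).2).1
  map_zero' := rfl
  map_add' _ _ := rfl

theorem xDeg_expo (i j : ℤ) (m n : ℕ) : xDeg (expo i j m n) = i := rfl

theorem yDeg_expo (i j : ℤ) (m n : ℕ) : yDeg (expo i j m n) = j := rfl

theorem exists_eq_expo (a : Exponent) : ∃ m n, a = expo (xDeg a) (yDeg a) m n := ⟨_, _, rfl⟩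

/-- The bicharacter encoding `y x = q² x y` with `z` and `z'` central. -/
noncomputable def torusBichar (q : kˣ) : Exponent →+ Exponent →+ Additive kˣ :=
  ((AddMonoidHom.mul.comp yDeg).compl₂ xDeg).compr₂ (zmultiplesHom _ (Additive.ofMul (q ^ 2)))

theorem toMul_torusBichar (q : kˣ) (a b : Exponent) :
    (torusBichar q a b).toMul = q ^ (2 * (yDeg a * xDeg b)) := by
  simp [torusBichar, zpow_mul]

/-- The quantum torus `k⟨x^±1, y^±1⟩` with `y x = q² x y`, with central variables `z` and `z'`
adjoined. -/
abbrev Torus (q : kˣ) : Type _ := TwistedMonoidAlgebra (torusBichar q)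

/-- The monomial `x^i y^j z^m z'^n` of the quantum torus. -/
noncomputable def tmono (q : kˣ) (i j : ℤ) (m n : ℕ) : Torus q :=
  mono (torusBichar q) (expo i j m n) 1

theorem tmono_mul_tmono (q : kˣ) (i j i' j' : ℤ) (m n m' n' : ℕ) :
    tmono q i j m n * tmono q i' j' m' n' =
      (q : k) ^ (2 * (j * i')) • tmono q (i + i') (j + j') (m + m') (n + n') := by
  rw [tmono, tmono, mono_mul_mono, toMul_torusBichar, tmono, ← map_smul, expo_add_expo,
    smul_eq_mul, mul_one, Units.val_zpow_eq_zpow_val, yDeg_expo, xDeg_expo]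

/-- The image of `e₁` in the quantum torus, `(z' - x²) y⁻¹`. -/
noncomputable def tE₁ (q : kˣ) : Torus q := tmono q 0 (-1) 0 1 - tmono q 2 (-1) 0 0

/-- The image of `e₂` in the quantum torus, `x⁻¹ (y - z)`. -/
noncomputable def tE₂ (q : kˣ) : Torus q := tmono q (-1) 1 0 0 - tmono q (-1) 0 1 0

variable (q : kˣ)

theorem tE₁_mul_tE₂ : tE₁ q * tE₂ q - (q : k) ^ 2 • (tE₂ q * tE₁ q) =
    ((q : k) ^ 2 * (q ^ 4 - 1)) • tmono q 1 0 0 0 := by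
  have hq := q.ne_zero
  simp only [tE₁, tE₂, mul_sub, sub_mul, tmono_mul_tmono, smul_sub]
  norm_num
  match_scalars <;> field_simp <;> ring

theorem tE₁_mul_x : tE₁ q * tmono q 1 0 0 0 = ((q : k) ^ 2)⁻¹ • (tmono q 1 0 0 0 * tE₁ q) := by
  simp only [tE₁, mul_sub, sub_mul, tmono_mul_tmono, smul_sub]
  norm_num

theorem tE₂_mul_x_sub : tE₂ q * tmono q 1 0 0 0 - (q : k) ^ 2 • (tmono q 1 0 0 0 * tE₂ q) =
    ((q : k) ^ 2 - 1) • tmono q 0 0 1 0 := by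
  simp only [tE₂, mul_sub, sub_mul, tmono_mul_tmono, smul_sub]
  norm_num
  module

theorem tE₂_mul_z : tE₂ q * tmono q 0 0 1 0 = tmono q 0 0 1 0 * tE₂ q := by
  simp only [tE₂, mul_sub, sub_mul, tmono_mul_tmono]
  norm_num

theorem tE₂_mul_x_sub' : tE₂ q * tmono q 1 0 0 0 - tmono q 1 0 0 0 * tE₂ q =
    ((q : k) ^ 2 - 1) • tmono q 0 1 0 0 := by
  simp only [tE₂, mul_sub, sub_mul, tmono_mul_tmono]
  norm_num
  module

theorem tE₁_mul_y : tE₁ q * tmono q 0 1 0 0 - ((q : k) ^ 4)⁻¹ • (tmono q 0 1 0 0 * tE₁ q) =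
    (1 - ((q : k) ^ 4)⁻¹) • tmono q 0 0 0 1 := by
  have hq := q.ne_zero
  simp only [tE₁, mul_sub, sub_mul, tmono_mul_tmono, smul_sub]
  norm_num
  match_scalars
  field_simp

theorem serreRel_lift_eq {q : k} (hq : q ≠ 0) {A : Type*} [Ring A] [Algebra k A] {a b c d : A}
    (hc : a * b - q ^ 2 • (b * a) = c) (hac : a * c = (q ^ 2)⁻¹ • (c * a))
    (hd : b * c - q ^ 2 • (c * b) = d) (hbd : b * d = d * b) ⦃x y : FreeAlgebra k (Fin 2)⦄
    (h : SerreRel q x y) : FreeAlgebra.lift k ![a, b] x = FreeAlgebra.lift k ![a, b] y := by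
  subst hc hd
  rcases h with _ | _ <;>
    simp only [map_add, map_smul, map_mul, map_pow, FreeAlgebra.lift_ι_apply, Matrix.cons_val_zero,
      Matrix.cons_val_one] <;>
    simp only [mul_sub, sub_mul, mul_smul_comm, smul_mul_assoc, mul_assoc, pow_succ, pow_zero,
      one_mul] at hac hbd ⊢
  · linear_combination (norm := skip) hac
    match_scalars <;> field_simp <;> ring
  · linear_combination (norm := skip) (-(q ^ 2)⁻¹) • hbd
    match_scalars <;> field_simp <;> ring

/-- The embedding of `U⁺` into the quantum torus. -/
noncomputable def toTorus : UPlus (q : k) →ₐ[k] Torus q :=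
  lift (q : k) (FreeAlgebra.lift k ![tE₁ q, tE₂ q]) <|
    serreRel_lift_eq q.ne_zero (tE₁_mul_tE₂ q)
      (by rw [mul_smul_comm, tE₁_mul_x, smul_mul_assoc, smul_comm])
      (by rw [mul_smul_comm, smul_mul_assoc, smul_comm ((q : k) ^ 2), ← smul_sub, tE₂_mul_x_sub])
      (by simp only [mul_smul_comm, smul_mul_assoc, tE₂_mul_z])

theorem toTorus_e₁ : toTorus q (e₁ (q : k)) = tE₁ q :=
  (lift_mk _ _ _ _).trans (FreeAlgebra.lift_ι_apply _ _)

theorem toTorus_e₂ : toTorus q (e₂ (q : k)) = tE₂ q :=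
  (lift_mk _ _ _ _).trans (FreeAlgebra.lift_ι_apply _ _)

theorem toTorus_e₃ : toTorus q (e₃ (q : k)) = ((q : k) ^ 2 * (q ^ 4 - 1)) • tmono q 1 0 0 0 := by
  rw [e₃, map_sub, map_smul, map_mul, map_mul, toTorus_e₁, toTorus_e₂, tE₁_mul_tE₂]

theorem toTorus_z :
    toTorus q (z (q : k)) = ((q : k) ^ 2 * (q ^ 4 - 1) * (q ^ 2 - 1)) • tmono q 0 0 1 0 := by
  rw [z, map_sub, map_smul, map_mul, map_mul, toTorus_e₃, toTorus_e₂, mul_smul_comm,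
    smul_mul_assoc, smul_comm ((q : k) ^ 2), ← smul_sub, tE₂_mul_x_sub, smul_smul]

theorem toTorus_w :
    toTorus q (w (q : k)) = ((q : k) ^ 2 * (q ^ 4 - 1) * (q ^ 2 - 1)) • tmono q 0 1 0 0 := by
  rw [w, map_sub, map_mul, map_mul, toTorus_e₃, toTorus_e₂, mul_smul_comm, smul_mul_assoc,
    ← smul_sub, tE₂_mul_x_sub', smul_smul]

theorem toTorus_z' : toTorus q (z' (q : k)) =
    ((q : k) ^ 2 * (q ^ 4 - 1) * (q ^ 2 - 1) * (1 - ((q : k) ^ 4)⁻¹)) •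
      tmono q 0 0 0 1 := by
  rw [z', map_sub, map_smul, map_mul, map_mul, toTorus_w, toTorus_e₁, mul_smul_comm,
    smul_mul_assoc, smul_comm ((q : k) ^ 4)⁻¹, ← smul_sub, tE₁_mul_y, smul_smul]

end Torus

end UqB2

namespace UqB2

section Embedding

open TwistedMonoidAlgebra

variable {k : Type*} [Field k] {q : kˣ}

theorem smul_tmono (c : k) (i j : ℤ) (m n : ℕ) :
    c • tmono q i j m n = mono (torusBichar q) (expo i j m n) c := by
  rw [tmono, ← map_smul, smul_eq_mul, mul_one]

theorem isGreatest_supp_toTorus_e₁ :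
    IsGreatest ((toTorus q (e₁ (q : k))).supp : Set Exponent) (expo 0 (-1) 0 1) := by
  rw [toTorus_e₁]
  exact isGreatest_supp_mono_sub_mono (expo_lt_expo.2 (by norm_num)) one_ne_zero 1

theorem isGreatest_supp_toTorus_e₂ :
    IsGreatest ((toTorus q (e₂ (q : k))).supp : Set Exponent) (expo (-1) 1 0 0) := by
  rw [toTorus_e₂]
  exact isGreatest_supp_mono_sub_mono (expo_lt_expo.2 (by norm_num)) one_ne_zero 1

/-- The leading exponent of the image of `pbw q s` in the quantum torus. -/
def pbwExponent (s : ℕ × ℕ × ℕ × ℕ) : Exponent :=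
  expo (s.2.1 - s.2.2.1) (s.2.2.1 - s.2.2.2) s.1 s.2.2.2

theorem pbwExponent_injective : Function.Injective pbwExponent := by
  rintro ⟨a, b, c, d⟩ ⟨a', b', c', d'⟩ h
  simp only [pbwExponent, expo_inj] at h
  simp only [Prod.mk.injEq]
  omega

theorem exists_toTorus_e₃ (h4 : (q : k) ^ 4 ≠ 1) :
    ∃ c : k, c ≠ 0 ∧ toTorus q (e₃ (q : k)) = mono (torusBichar q) (expo 1 0 0 0) c := by
  refine ⟨_, ?_, (toTorus_e₃ q).trans (smul_tmono ..)⟩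
  simp [sub_eq_zero, h4]

theorem exists_toTorus_z (h4 : (q : k) ^ 4 ≠ 1) :
    ∃ c : k, c ≠ 0 ∧ toTorus q (z (q : k)) = mono (torusBichar q) (expo 0 0 1 0) c := by
  refine ⟨_, ?_, (toTorus_z q).trans (smul_tmono ..)⟩
  simp [sub_eq_zero, h4, sq_ne_one_of_pow_four_ne_one h4]

theorem exists_toTorus_w (h4 : (q : k) ^ 4 ≠ 1) :
    ∃ c : k, c ≠ 0 ∧ toTorus q (w (q : k)) = mono (torusBichar q) (expo 0 1 0 0) c := by
  refine ⟨_, ?_, (toTorus_w q).trans (smul_tmono ..)⟩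
  simp [sub_eq_zero, h4, sq_ne_one_of_pow_four_ne_one h4]

theorem exists_toTorus_z' (h4 : (q : k) ^ 4 ≠ 1) :
    ∃ c : k, c ≠ 0 ∧ toTorus q (z' (q : k)) = mono (torusBichar q) (expo 0 0 0 1) c := by
  refine ⟨_, ?_, (toTorus_z' q).trans (smul_tmono ..)⟩
  simp [sub_eq_zero, h4, sq_ne_one_of_pow_four_ne_one h4, eq_comm (a := (1 : k))]

theorem isGreatest_supp_toTorus_pbw (h4 : (q : k) ^ 4 ≠ 1) (s : ℕ × ℕ × ℕ × ℕ) :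
    IsGreatest ((toTorus q (pbw (q : k) s)).supp : Set Exponent) (pbwExponent s) := by
  obtain ⟨a, b, c, d⟩ := s
  obtain ⟨cz, hcz, hz⟩ := exists_toTorus_z h4
  obtain ⟨ce, hce, he⟩ := exists_toTorus_e₃ h4
  have hexp : pbwExponent (a, b, c, d) = a • expo 0 0 1 0 + (b • expo 1 0 0 0 +
      (c • expo (-1) 1 0 0 + d • expo 0 (-1) 0 1)) := by
    simp only [pbwExponent, nsmul_expo, expo_add_expo, expo_inj]
    omega
  rw [hexp, pbw, map_mul, map_mul, map_mul, map_pow, map_pow, map_pow, map_pow, hz, he]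
  exact isGreatest_supp_mul (isGreatest_supp_pow (isGreatest_supp_mono _ hcz) a) <|
    isGreatest_supp_mul (isGreatest_supp_pow (isGreatest_supp_mono _ hce) b) <|
    isGreatest_supp_mul (isGreatest_supp_pow isGreatest_supp_toTorus_e₂ c)
      (isGreatest_supp_pow isGreatest_supp_toTorus_e₁ d)

theorem exists_isGreatest_supp_toTorus (h4 : (q : k) ^ 4 ≠ 1) {f : UPlus (q : k)} (hf : f ≠ 0) :
    ∃ s, IsGreatest ((toTorus q f).supp : Set Exponent) (pbwExponent s) := by
  have hspan : f ∈ Submodule.span k (Set.range (pbw (q : k))) :=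
    span_pbw q.ne_zero ▸ Submodule.mem_top
  obtain ⟨c, rfl⟩ := Finsupp.mem_span_range_iff_exists_finsupp.1 hspan
  have hc : c ≠ 0 := by rintro rfl; exact hf Finsupp.sum_zero_index
  rw [← Finsupp.linearCombination_apply, ← AlgHom.toLinearMap_apply,
    Finsupp.apply_linearCombination]
  exact exists_isGreatest_supp_linearCombination pbwExponent_injective
    (isGreatest_supp_toTorus_pbw h4) hc

theorem toTorus_injective (h4 : (q : k) ^ 4 ≠ 1) : Function.Injective (toTorus q) := by
  refine (injective_iff_map_eq_zero _).2 fun f hf => ?_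
  by_contra hne
  obtain ⟨s, hs⟩ := exists_isGreatest_supp_toTorus h4 hne
  exact supp_nonempty.1 ⟨_, hs.1⟩ hf

theorem nonneg_of_tmono_mem_range (h4 : (q : k) ^ 4 ≠ 1) {i j : ℤ} {m n : ℕ}
    (h : tmono q i j m n ∈ (toTorus q).range) : 0 ≤ j + n ∧ 0 ≤ i + j + n := by
  obtain ⟨f, hf⟩ := h
  have hlead : IsGreatest ((toTorus q f).supp : Set Exponent) (expo i j m n) :=
    hf ▸ isGreatest_supp_mono _ one_ne_zero
  have hne : f ≠ 0 := by
    rintro rfl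
    exact supp_nonempty.1 ⟨_, hlead.1⟩ (map_zero _)
  obtain ⟨⟨a, b, c, d⟩, hs⟩ := exists_isGreatest_supp_toTorus h4 hne
  obtain ⟨hi, hj, -, hn⟩ := expo_inj.1 (hlead.unique hs)
  dsimp only at hi hj hn
  omega

end Embedding

section Normal

open TwistedMonoidAlgebra

variable {k : Type*} [Field k] {q : kˣ}

theorem mul_tmono_of_forall_mem_supp {f : Torus q} {i j : ℤ} (hx : ∀ b ∈ f.supp, xDeg b = i)
    (hy : ∀ b ∈ f.supp, yDeg b = j) (i' j' : ℤ) (m n : ℕ) :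
    f * tmono q i' j' m n =
      ((q ^ (2 * (j * i' - j' * i)) : kˣ) : k) • (tmono q i' j' m n * f) := by
  refine mul_mono_eq_smul_mono_mul (fun b hb => ?_) 1
  rw [toMul_torusBichar, toMul_torusBichar, hx b hb, hy b hb, ← zpow_add, xDeg_expo, yDeg_expo]
  congr 1
  ring

theorem IsNormalElement.exists_mul_eq {A : Type*} [Mul A] {f : A} (hf : IsNormalElement f) (u : A) :
    ∃ g, g * f = f * u :=
  hf.subset ⟨u, rfl⟩

variable {f : UPlus (q : k)}

theorem IsNormalElement.yDeg_eq (hq : ¬IsOfFinOrder q) (hf : IsNormalElement f) {a b : Exponent}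
    (ha : a ∈ (toTorus q f).supp) (hb : b ∈ (toTorus q f).supp) : yDeg a = yDeg b := by
  obtain ⟨c, hc, he₃⟩ := exists_toTorus_e₃ (val_pow_ne_one_of_not_isOfFinOrder hq four_pos)
  obtain ⟨g, hg⟩ := hf.exists_mul_eq (e₃ (q : k))
  have h : toTorus q g * toTorus q f = toTorus q f * mono _ (expo 1 0 0 0) c := by
    rw [← map_mul, hg, map_mul, he₃]
  have := toMul_mul_eq_of_mul_eq_mul_mono hc h ha hb
  simp only [toMul_torusBichar, xDeg_expo, yDeg_expo, zero_mul, mul_zero, zpow_zero,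
    mul_one] at this
  exact (zpow_two_mul_inj_of_not_isOfFinOrder hq).1 this

theorem IsNormalElement.xDeg_eq (hq : ¬IsOfFinOrder q) (hf : IsNormalElement f) {a b : Exponent}
    (ha : a ∈ (toTorus q f).supp) (hb : b ∈ (toTorus q f).supp) : xDeg a = xDeg b := by
  obtain ⟨c, hc, hw⟩ := exists_toTorus_w (val_pow_ne_one_of_not_isOfFinOrder hq four_pos)
  obtain ⟨g, hg⟩ := hf.exists_mul_eq (w (q : k))
  have h : toTorus q g * toTorus q f = toTorus q f * mono _ (expo 0 1 0 0) c := by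
    rw [← map_mul, hg, map_mul, hw]
  have := toMul_mul_eq_of_mul_eq_mul_mono hc h ha hb
  simp only [toMul_torusBichar, xDeg_expo, yDeg_expo, one_mul, mul_zero, zpow_zero] at this
  exact ((zpow_two_mul_inj_of_not_isOfFinOrder hq).1 this).symm

theorem IsNormalElement.mul_sub_mul_eq_of_toTorus_eq_sub (hq : ¬IsOfFinOrder q)
    (hf : IsNormalElement f) {i j : ℤ} (hf0 : f ≠ 0) (hx : ∀ b ∈ (toTorus q f).supp, xDeg b = i)
    (hy : ∀ b ∈ (toTorus q f).supp, yDeg b = j) {e : UPlus (q : k)} {i₁ j₁ i₂ j₂ : ℤ}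
    {m₁ n₁ m₂ n₂ : ℕ} (he : toTorus q e = tmono q i₁ j₁ m₁ n₁ - tmono q i₂ j₂ m₂ n₂)
    (hmem : tmono q i₂ j₂ m₂ n₂ ∉ (toTorus q).range) :
    j * i₁ - j₁ * i = j * i₂ - j₂ * i := by
  obtain ⟨g, hg⟩ := hf.exists_mul_eq e
  have hinj := toTorus_injective (val_pow_ne_one_of_not_isOfFinOrder hq four_pos)
  refine (zpow_two_mul_inj_of_not_isOfFinOrder hq).1 <| Units.ext <|
    eq_of_mul_sub_mem (W := Subalgebra.toSubmodule (toTorus q).range)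
    (f := toTorus q f) (g := toTorus q g) ((map_ne_zero_iff _ hinj).2 hf0)
    (mul_tmono_of_forall_mem_supp hx hy i₁ j₁ m₁ n₁)
    (mul_tmono_of_forall_mem_supp hx hy i₂ j₂ m₂ n₂) ?_ ⟨g, rfl⟩ ⟨e, he⟩ hmem
  rw [← he, ← map_mul, hg, map_mul]

theorem IsNormalElement.xDeg_eq_zero_and_yDeg_eq_zero (hq : ¬IsOfFinOrder q)
    (hf : IsNormalElement f) {a : Exponent} (ha : a ∈ (toTorus q f).supp) :
    xDeg a = 0 ∧ yDeg a = 0 := by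
  have h4 := val_pow_ne_one_of_not_isOfFinOrder hq four_pos
  have hf0 : f ≠ 0 := by
    rintro rfl
    exact supp_nonempty.1 ⟨a, ha⟩ (map_zero _)
  have hx : ∀ b ∈ (toTorus q f).supp, xDeg b = xDeg a := fun b hb => hf.xDeg_eq hq hb ha
  have hy : ∀ b ∈ (toTorus q f).supp, yDeg b = yDeg a := fun b hb => hf.yDeg_eq hq hb ha
  have h₁ := hf.mul_sub_mul_eq_of_toTorus_eq_sub hq hf0 hx hy (toTorus_e₁ q) fun h => by
    have := nonneg_of_tmono_mem_range h4 h
    omega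
  have h₂ := hf.mul_sub_mul_eq_of_toTorus_eq_sub hq hf0 hx hy (toTorus_e₂ q) fun h => by
    have := nonneg_of_tmono_mem_range h4 h
    omega
  omega

theorem exists_toTorus_z_pow_mul_z'_pow (h4 : (q : k) ^ 4 ≠ 1) (m n : ℕ) :
    ∃ c : k, c ≠ 0 ∧ toTorus q (z (q : k) ^ m * z' (q : k) ^ n) =
      mono (torusBichar q) (expo 0 0 m n) c := by
  obtain ⟨c, hc, hz⟩ := exists_toTorus_z h4
  obtain ⟨c', hc', hz'⟩ := exists_toTorus_z' h4
  have hβ (i j m n i' m' n') : torusBichar q (expo i 0 m n) (expo i' j m' n') = 0 :=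
    Additive.toMul.injective (by simp [toMul_torusBichar, yDeg_expo])
  refine ⟨c ^ m * c' ^ n, mul_ne_zero (pow_ne_zero m hc) (pow_ne_zero n hc'), ?_⟩
  rw [map_mul, map_pow, map_pow, hz, hz', mono_pow _ (hβ ..), mono_pow _ (hβ ..), mono_mul_mono,
    nsmul_expo, nsmul_expo, expo_add_expo]
  simp [hβ]

theorem mono_mem_map_adjoin (h4 : (q : k) ^ 4 ≠ 1) {a : Exponent} (hx : xDeg a = 0)
    (hy : yDeg a = 0) (r : k) :
    mono (torusBichar q) a r ∈ (Algebra.adjoin k {z (q : k), z' (q : k)}).map (toTorus q) := by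
  obtain ⟨m, n, ha⟩ := exists_eq_expo a
  obtain ⟨c, hc, hmn⟩ := exists_toTorus_z_pow_mul_z'_pow h4 m n
  have hr : mono (torusBichar q) a r = (r * c⁻¹) • toTorus q (z (q : k) ^ m * z' (q : k) ^ n) := by
    rw [hmn, ← map_smul, smul_eq_mul, inv_mul_cancel_right₀ hc, ha, hx, hy]
  rw [hr]
  have hz : z (q : k) ∈ Algebra.adjoin k {z (q : k), z' (q : k)} :=
    Algebra.subset_adjoin (Set.mem_insert _ _)
  have hz' : z' (q : k) ∈ Algebra.adjoin k {z (q : k), z' (q : k)} :=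
    Algebra.subset_adjoin (Set.mem_insert_of_mem _ rfl)
  exact Subalgebra.smul_mem _
    (Subalgebra.mem_map.2 ⟨_, mul_mem (pow_mem hz m) (pow_mem hz' n), rfl⟩) _

theorem IsNormalElement.mem_adjoin (hq : ¬IsOfFinOrder q) (hf : IsNormalElement f) :
    f ∈ Algebra.adjoin k {z (q : k), z' (q : k)} := by
  have h4 := val_pow_ne_one_of_not_isOfFinOrder hq four_pos
  have hmem : toTorus q f ∈ (Algebra.adjoin k {z (q : k), z' (q : k)}).map (toTorus q) := by
    rw [← sum_supp (toTorus q f)]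
    refine sum_mem fun a ha => ?_
    obtain ⟨hx, hy⟩ := hf.xDeg_eq_zero_and_yDeg_eq_zero hq ha
    exact mono_mem_map_adjoin h4 hx hy _
  obtain ⟨g, hg, hgf⟩ := hmem
  exact toTorus_injective h4 hgf ▸ hg

end Normal

section Center

open TwistedMonoidAlgebra

variable {k : Type*} [Field k] {q : kˣ}

theorem z'_mem_center (h4 : (q : k) ^ 4 ≠ 1) :
    z' (q : k) ∈ Subalgebra.center k (UPlus (q : k)) := by
  obtain ⟨c, -, hc⟩ := exists_toTorus_z' h4
  refine Subalgebra.mem_center_iff.2 fun f => toTorus_injective h4 ?_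
  rw [map_mul, map_mul, hc, mul_mono_eq_smul_mono_mul (u := 1), Units.val_one, one_smul]
  simp [toMul_torusBichar, xDeg_expo, yDeg_expo]

theorem adjoin_le_center (h4 : (q : k) ^ 4 ≠ 1) :
    Algebra.adjoin k {z (q : k), z' (q : k)} ≤ Subalgebra.center k (UPlus (q : k)) :=
  Algebra.adjoin_le <| Set.pair_subset (z_mem_center q.ne_zero) (z'_mem_center h4)

theorem isNormalElement_of_mem_center {R A : Type*} [CommSemiring R] [Semiring A] [Algebra R A]
    {f : A} (hf : f ∈ Subalgebra.center R A) : IsNormalElement f :=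
  congrArg Set.range <| funext fun u => (Subalgebra.mem_center_iff.1 hf u).symm

theorem linearIndependent_z_pow_mul_z'_pow (h4 : (q : k) ^ 4 ≠ 1) :
    LinearIndependent k fun m : Fin 2 →₀ ℕ => z (q : k) ^ m 0 * z' (q : k) ^ m 1 := by
  refine .of_comp (toTorus q).toLinearMap <|
    linearIndependent_of_isGreatest_supp (d := fun m => expo 0 0 (m 0) (m 1))
      (fun m m' h => ?_) fun m => ?_
  · obtain ⟨-, -, h₀, h₁⟩ := expo_inj.1 h
    ext i
    fin_cases i
    exacts [h₀, h₁]
  · obtain ⟨c, hc, hm⟩ := exists_toTorus_z_pow_mul_z'_pow h4 (m 0) (m 1)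
    rw [Function.comp_apply, AlgHom.toLinearMap_apply, hm]
    exact isGreatest_supp_mono _ hc

end Center

end UqB2

theorem lemma3p1_general {k : Type*} [Field k] (q : k) (hq0 : q ≠ 0)
    (hq : ∀ n : ℕ, 0 < n → q ^ n ≠ 1) :
    {f : UqB2.UPlus q | UqB2.IsNormalElement f}
        = (Subalgebra.center k (UqB2.UPlus q) : Set (UqB2.UPlus q)) ∧
      Subalgebra.center k (UqB2.UPlus q) = Algebra.adjoin k {UqB2.z q, UqB2.z' q} ∧
      (∃ φ : MvPolynomial (Fin 2) k ≃ₐ[k] Subalgebra.center k (UqB2.UPlus q),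
        (φ (MvPolynomial.X 0) : UqB2.UPlus q) = UqB2.z q ∧
        (φ (MvPolynomial.X 1) : UqB2.UPlus q) = UqB2.z' q) ∧
      UqB2.z q ∈ UqB2.component q 3 ∧ UqB2.z' q ∈ UqB2.component q 4 := by
  lift q to kˣ using hq0.isUnit
  have h4 : (q : k) ^ 4 ≠ 1 := hq 4 four_pos
  have hq' : ¬IsOfFinOrder q := fun h => by
    obtain ⟨n, hn, hqn⟩ := isOfFinOrder_iff_pow_eq_one.1 (Units.isOfFinOrder_val.2 h)
    exact hq n hn hqn
  have hcenter : Subalgebra.center k (UqB2.UPlus (q : k)) =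
      Algebra.adjoin k {UqB2.z (q : k), UqB2.z' (q : k)} :=
    le_antisymm (fun _ hf => (UqB2.isNormalElement_of_mem_center hf).mem_adjoin hq')
      (UqB2.adjoin_le_center h4)
  have hnormal : {f : UqB2.UPlus (q : k) | UqB2.IsNormalElement f}
      = (Subalgebra.center k (UqB2.UPlus (q : k)) : Set (UqB2.UPlus (q : k))) :=
    Set.Subset.antisymm (fun _ hf => UqB2.adjoin_le_center h4 (hf.mem_adjoin hq'))
      fun _ hf => UqB2.isNormalElement_of_mem_center hf
  exact ⟨hnormal, hcenter,
    exists_mvPolynomial_algEquiv_center hcenter (UqB2.linearIndependent_z_pow_mul_z'_pow h4),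
    UqB2.z_mem_component _, UqB2.z'_mem_component _⟩

theorem lemma3p1 {k : Type*} [Field k] [IsAlgClosed k] [CharZero k] (q : k) (hq0 : q ≠ 0)
    (hq : ∀ n : ℕ, 0 < n → q ^ n ≠ 1) :
    {f : UqB2.UPlus q | UqB2.IsNormalElement f}
        = (Subalgebra.center k (UqB2.UPlus q) : Set (UqB2.UPlus q)) ∧
      Subalgebra.center k (UqB2.UPlus q) = Algebra.adjoin k {UqB2.z q, UqB2.z' q} ∧
      (∃ φ : MvPolynomial (Fin 2) k ≃ₐ[k] Subalgebra.center k (UqB2.UPlus q),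
        (φ (MvPolynomial.X 0) : UqB2.UPlus q) = UqB2.z q ∧
        (φ (MvPolynomial.X 1) : UqB2.UPlus q) = UqB2.z' q) ∧
      UqB2.z q ∈ UqB2.component q 3 ∧ UqB2.z' q ∈ UqB2.component q 4 :=
  lemma3p1_general q hq0 hq
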